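/- Let $\mathbb{F}_3=\{0,1,2\}$ be the field of order $3$ and let $H(n,3)$ be the Hamming graph on $\mathbb{F}_3^n$, in which two words are adjacent if they differ in exactly one position. A $1$-perfect code in $H(n,3)$ is an independent set $C$ of vertices such that every vertex outside $C$ is adjacent to exactly one element of $C$; a Hamming code is a $1$-perfect code that is a linear subspace; the rank of a code is the dimension of its affine span. A $t$-ary quasigroup of order $3$ is a function $f:\mathbb{F}_3^t\to\mathbb{F}_3$ whose graph $\{(x,f(x)) : x\in\mathbb{F}_3^t\}\subset\mathbb{F}_3^{t+1}$ consists of $3^t$ words, any two different of which differ in at least two positions. **Theorem.** Let $m\ge 1$, $n=(3^m-1)/2$ and $n'=(3^{m-1}-1)/2=(n-1)/3$. Let $C$ be a $1$-perfect code in $H(n,3)$ of rank at most $n-m+1$, and let $C^\star\subseteq\mathbb{F}_3^{n'}$ be a Hamming code of length $n'$ (for $m=1$, $n'=0$ and $C^\star$ consists of the empty word). Then there are an automorphism $\psi$ of the graph $H(n,3)$ and, for each $\mu=(\mu_0,\dots,\mu_{n'-1})\in C^\star$, an $n'$-ary quasigroup $\lambda_\mu$ of order $3$ such that $$\psi(C)=\bigcup_{\mu\in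 C^\star}K_\mu,$$ where $K_\mu$ is the set of all words $(x_0,x_1,\dots,x_{n-1})\in\mathbb{F}_3^n$ satisfying $$x_{3i+2}=\mu_i-x_{3i}-x_{3i+1}\quad\text{for } i=0,\dots,n'-1,$$ $$x_{n-1}=\lambda_\mu(x_1-x_0,\;x_4-x_3,\;\dots,\;x_{n-3}-x_{n-4}).$$ -/

import Mathlib

/-- Words of length `n` over the alphabet `{0, 1, 2}`, regarded as the field with three elements;
they form the vector space of dimension `n` over that field. -/
abbrev Word (n : ℕ) : Type := Fin n → ZMod 3

/-- The Hamming graph `H(n,3)`: two words are adjacent iff they differ in exactly one symbol. -/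
def hammingGraph3 (n : ℕ) : SimpleGraph (Word n) where
  Adj x y := hammingDist x y = 1
  symm := ⟨fun x y h => by rw [hammingDist_comm]; exact h⟩
  loopless := ⟨fun x h => by simp at h⟩

/-- A `1`-perfect code in a graph: an independent set of vertices such that every vertex outside of
it is adjacent to exactly one vertex of it. -/
def IsOnePerfect {V : Type*} (G : SimpleGraph V) (C : Set V) : Prop :=
  G.IsIndepSet C ∧ ∀ v, v ∉ C → ∃! c, c ∈ C ∧ G.Adj v c

/-- A Hamming code: a linear `1`-perfect code. -/
def IsHammingCode {n : ℕ} (C : Submodule (ZMod 3) (Word n)) : Prop :=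
  IsOnePerfect (hammingGraph3 n) (C : Set (Word n))

/-- The rank of a code: the dimension of its affine span. -/
noncomputable def codeRank {n : ℕ} (C : Set (Word n)) : ℕ :=
  Module.finrank (ZMod 3) (affineSpan (ZMod 3) C).direction

/-- `C` is an `(n, M, d)₃` code: it has `M` codewords, and no two different codewords are at
distance less than `d`. -/
def IsCodeWithParams (n M d : ℕ) (C : Set (Word n)) : Prop :=
  C.ncard = M ∧ ∀ x ∈ C, ∀ y ∈ C, x ≠ y → d ≤ hammingDist x y

/-- A `t`-ary quasigroup of order `3`: a function whose graph `{(x, f x)}` is a distance-`2` MDS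
code, that is, a `(t + 1, 3 ^ t, 2)₃` code. -/
def IsQuasigroup3 {t : ℕ} (f : Word t → ZMod 3) : Prop :=
  IsCodeWithParams (t + 1) (3 ^ t) 2
    (Set.range fun x : Word t => (Fin.snoc x (f x) : Word (t + 1)))

theorem length_eq_three_mul_add_one {m : ℕ} (hm : 1 ≤ m) :
    (3 ^ m - 1) / 2 = 3 * ((3 ^ (m - 1) - 1) / 2) + 1 := by
  obtain ⟨k, rfl⟩ : ∃ k, m = k + 1 := ⟨m - 1, by omega⟩
  have hodd : (3 ^ k) % 2 = 1 := by
    rw [Nat.pow_mod]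
    simp
  rw [Nat.add_sub_cancel, pow_succ]
  omega

/-- The position `3 i + j` in a word of length `n = 3 t + 1`. -/
def tripleCoord {n t : ℕ} (h : n = 3 * t + 1) (i : Fin t) (j : Fin 3) : Fin n :=
  ⟨3 * i.val + j.val, by omega⟩

/-- The last position, `n - 1 = 3 t`, in a word of length `n = 3 t + 1`. -/
def lastCoord {n t : ℕ} (h : n = 3 * t + 1) : Fin n :=
  ⟨3 * t, by omega⟩

/-- The `μ`-component given by the function `f`: the set of all words `(x_0, …, x_{n-1})` with
`x_{3i+2} = μ_i - x_{3i} - x_{3i+1}` for each `i`, and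
`x_{n-1} = f (x_1 - x_0, x_4 - x_3, …, x_{n-3} - x_{n-4})`. -/
def muComponent {n t : ℕ} (h : n = 3 * t + 1) (μ : Word t) (f : Word t → ZMod 3) :
    Set (Word n) :=
  {x | (∀ i : Fin t, x (tripleCoord h i 2) =
          μ i - x (tripleCoord h i 0) - x (tripleCoord h i 1)) ∧
        x (lastCoord h) = f fun i => x (tripleCoord h i 1) - x (tripleCoord h i 0)}

/-!
A linear map `S` of rank `m - 1` is constant on `C`, since the rank of `C` is small. Counting the
pairs (error, codeword) shows that every syndrome is the `S`-value of exactly three errors of weight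
at most one. Hence one column of `S` vanishes and the others come, up to scalars, in triples of
equal columns, which run through the columns of a parity check of `C⋆`. So some isometry takes `C`
to a perfect code `D` whose block sums, over blocks of three positions, lie in `C⋆`.

Adding a constant to all the symbols of a block preserves `D`: starting from `z ∈ D`, add `a` to two
symbols of the block; the codeword nearest to the result can only be obtained by adding `a` to the
third symbol. So membership in `D` depends only on the block sums, the differences within the blocks
and the last symbol, and the last symbol is a function of the rest, whose graph has minimum
distance two because `D` has minimum distance three.
-/

section HammingDistance

theorem eq_and_eq_of_single_eq_single {ι M : Type*} [DecidableEq ι] [Zero M] {i j : ι} {a b : M}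
    (ha : a ≠ 0) (h : (Pi.single i a : ι → M) = Pi.single j b) : i = j ∧ a = b := by
  have hi := congrFun h i
  obtain rfl | hij := eq_or_ne i j
  · simpa using hi
  · simp [Pi.single_eq_of_ne hij, ha] at hi

theorem hammingNorm_le_one_iff {ι : Type*} [Fintype ι] [DecidableEq ι] {α : ι → Type*}
    [∀ i, DecidableEq (α i)] [∀ i, Zero (α i)] {x : ∀ i, α i} :
    hammingNorm x ≤ 1 ↔ x = 0 ∨ ∃ i, ∃ a ≠ 0, x = Pi.single i a := by
  constructor
  · intro hx
    refine or_iff_not_imp_left.2 fun hne => ?_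
    obtain ⟨i, hi⟩ := Function.ne_iff.1 hne
    refine ⟨i, x i, hi, funext fun j => ?_⟩
    obtain rfl | hji := eq_or_ne j i
    · rw [Pi.single_eq_same]
    · rw [Pi.single_eq_of_ne hji]
      by_contra hj
      exact hji (Finset.card_le_one.1 hx j (by simpa using hj) i (by simpa using hi))
  · rintro (rfl | ⟨i, a, -, rfl⟩)
    · simp
    · refine (Finset.card_le_card (t := {i}) fun j hj => ?_).trans_eq (Finset.card_singleton i)
      rw [Finset.mem_singleton]
      by_contra hji
      simp [Pi.single_eq_of_ne hji] at hj

theorem hammingNorm_single_le_one {ι M : Type*} [Fintype ι] [DecidableEq ι] [DecidableEq M]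
    [Zero M] (i : ι) (a : M) : hammingNorm (Pi.single i a : ι → M) ≤ 1 := by
  obtain rfl | ha := eq_or_ne a 0
  · simp
  · exact hammingNorm_le_one_iff.2 (.inr ⟨i, a, ha, rfl⟩)

theorem hammingDist_snoc {n : ℕ} {α : Type*} [DecidableEq α] (x y : Fin n → α) (a b : α) :
    hammingDist (Fin.snoc x a : Fin (n + 1) → α) (Fin.snoc y b) =
      hammingDist x y + if a ≠ b then 1 else 0 := by
  simp only [hammingDist, Finset.card_filter, Fin.sum_univ_castSucc, Fin.snoc_castSucc,
    Fin.snoc_last]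

theorem hammingDist_comp_equiv {ι κ α : Type*} [Fintype ι] [Fintype κ] [DecidableEq α]
    (e : κ ≃ ι) (x y : ι → α) : hammingDist (x ∘ e) (y ∘ e) = hammingDist x y :=
  Finset.card_equiv e (by simp)

theorem hammingNorm_neg {ι G : Type*} [Fintype ι] [AddGroup G] [DecidableEq G] (x : ι → G) :
    hammingNorm (-x) = hammingNorm x := by
  simp only [hammingNorm, Pi.neg_apply, ne_eq, neg_eq_zero]

theorem hammingDist_self_add {ι G : Type*} [Fintype ι] [AddGroup G] [DecidableEq G]
    (x y : ι → G) : hammingDist x (x + y) = hammingNorm y := by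
  rw [hammingDist_eq_hammingNorm, neg_add_cancel_left]

theorem card_hammingNorm_le_one {ι K : Type*} [Fintype ι] [Field K] [Finite K] [DecidableEq K] :
    Nat.card {e : ι → K // hammingNorm e ≤ 1} = Fintype.card ι * (Nat.card K - 1) + 1 := by
  classical
  let error : Option (ι × Kˣ) → {e : ι → K // hammingNorm e ≤ 1} :=
    fun o => o.elim ⟨0, by simp⟩ fun p => ⟨Pi.single p.1 p.2, hammingNorm_single_le_one _ _⟩
  have herror : Function.Bijective error := by
    constructor
    · rintro (_ | ⟨i, a⟩) (_ | ⟨j, b⟩) hab <;>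
        simp only [error, Option.elim, Subtype.mk.injEq] at hab
      · rfl
      · simp [eq_comm] at hab
      · simp at hab
      · obtain ⟨rfl, h⟩ := eq_and_eq_of_single_eq_single a.ne_zero hab
        rw [Units.ext h]
    · rintro ⟨e, he⟩
      obtain rfl | ⟨i, a, ha, rfl⟩ := hammingNorm_le_one_iff.1 he
      · exact ⟨none, rfl⟩
      · exact ⟨some (i, Units.mk0 a ha), rfl⟩
  rw [← Nat.card_eq_of_bijective error herror, Finite.card_option, Nat.card_prod,
    Nat.card_eq_fintype_card, Nat.card_units]

end HammingDistance

/-- A perfect one-error-correcting code: the balls of radius one around its codewords partition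
the words. For ternary words this is the notion of a `1`-perfect code in the Hamming graph, with
adjacency replaced by the Hamming distance so that any index type and alphabet are allowed. -/
def IsPerfectCode {ι α : Type*} [Fintype ι] [DecidableEq α] (C : Set (ι → α)) : Prop :=
  ∀ x, ∃! c, c ∈ C ∧ hammingDist x c ≤ 1

theorem IsOnePerfect.isPerfectCode {n : ℕ} {C : Set (Word n)}
    (hC : IsOnePerfect (hammingGraph3 n) C) : IsPerfectCode C := by
  have adj_of_ne {x y : Word n} (hne : x ≠ y) (h : hammingDist x y ≤ 1) :
      (hammingGraph3 n).Adj x y := le_antisymm h (hammingDist_pos.2 hne)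
  intro x
  by_cases hx : x ∈ C
  · refine ⟨x, ⟨hx, by simp⟩, fun c ⟨hc, hxc⟩ => ?_⟩
    by_contra hne
    exact hC.1 hx hc (Ne.symm hne) (adj_of_ne (Ne.symm hne) hxc)
  · obtain ⟨c, ⟨hc, hadj⟩, huniq⟩ := hC.2 x hx
    exact ⟨c, ⟨hc, le_of_eq hadj⟩, fun d ⟨hd, hxd⟩ =>
      huniq d ⟨hd, adj_of_ne (ne_of_mem_of_not_mem hd hx).symm hxd⟩⟩

namespace IsPerfectCode

section Basic

variable {ι : Type*} [Fintype ι]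

theorem preimage {κ α β : Type*} [Fintype κ] [DecidableEq α] [DecidableEq β] {C : Set (ι → α)}
    (hC : IsPerfectCode C) (f : (κ → β) ≃ (ι → α))
    (hf : ∀ x y, hammingDist (f x) (f y) = hammingDist x y) : IsPerfectCode (f ⁻¹' C) :=
  fun x => (f.existsUnique_congr fun c => by simp only [Set.mem_preimage, hf]).2 (hC (f x))

theorem nonempty {α : Type*} [DecidableEq α] [Nonempty α] {C : Set (ι → α)}
    (hC : IsPerfectCode C) : C.Nonempty :=
  let ⟨c, ⟨hc, _⟩, _⟩ := hC (Classical.arbitrary _)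
  ⟨c, hc⟩

section AddGroup

variable {G : Type*} [AddGroup G] [DecidableEq G] {C : Set (ι → G)}

theorem exists_add_mem (hC : IsPerfectCode C) (x : ι → G) :
    ∃ e, hammingNorm e ≤ 1 ∧ x + e ∈ C := by
  obtain ⟨c, ⟨hc, hxc⟩, -⟩ := hC x
  exact ⟨-x + c, by rwa [← hammingDist_eq_hammingNorm], by rwa [add_neg_cancel_left]⟩

theorem eq_of_add_eq_add (hC : IsPerfectCode C) {c d e f : ι → G} (hc : c ∈ C) (hd : d ∈ C)
    (he : hammingNorm e ≤ 1) (hf : hammingNorm f ≤ 1) (h : c + e = d + f) : c = d :=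
  (hC (c + e)).unique ⟨hc, by rwa [hammingDist_comm, hammingDist_self_add]⟩
    ⟨hd, by rwa [h, hammingDist_comm, hammingDist_self_add]⟩

theorem add_eq_zero_of_add_add_mem (hC : IsPerfectCode C) {c e f : ι → G} (hc : c ∈ C)
    (he : hammingNorm e ≤ 1) (hf : hammingNorm f ≤ 1) (h : c + e + f ∈ C) : e + f = 0 := by
  have := hC.eq_of_add_eq_add hc h he ((hammingNorm_neg f).trans_le hf)
    (add_neg_cancel_right _ _).symm
  rwa [add_assoc, left_eq_add] at this

theorem bijective_add_error (hC : IsPerfectCode C) :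
    Function.Bijective fun p : {e : ι → G // hammingNorm e ≤ 1} × C => p.2.1 + p.1.1 := by
  constructor
  · rintro ⟨⟨e, he⟩, ⟨c, hc⟩⟩ ⟨⟨f, hf⟩, ⟨d, hd⟩⟩ h
    obtain rfl : c = d := hC.eq_of_add_eq_add hc hd he hf h
    obtain rfl : e = f := add_left_cancel h
    rfl
  · intro x
    obtain ⟨e, he, hx⟩ := hC.exists_add_mem x
    exact ⟨⟨⟨-e, (hammingNorm_neg e).trans_le he⟩, ⟨x + e, hx⟩⟩, add_neg_cancel_right x e⟩

end AddGroup

section Syndrome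

variable {K Q : Type*} [Field K] [DecidableEq K] [AddCommGroup Q] [Module K Q] {C : Set (ι → K)}
  {S : (ι → K) →ₗ[K] Q} {s₀ : Q}

theorem card_error_fiber_mul_card (hC : IsPerfectCode C) (hSC : ∀ c ∈ C, S c = s₀) (s : Q) :
    Nat.card {e : {e : ι → K // hammingNorm e ≤ 1} // S e = s} * Nat.card C =
      Nat.card {x // S x = s₀ + s} := by
  rw [← Nat.card_prod, ← Nat.card_congr (Equiv.prodSubtypeFstEquivSubtypeProd
    (p := fun e : {e : ι → K // hammingNorm e ≤ 1} => S e = s))]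
  exact Nat.card_congr ((Equiv.ofBijective _ hC.bijective_add_error).subtypeEquiv
    fun p => by simp [hSC _ p.2.2])

theorem card_error_fiber_mul_card_syndrome [Finite K] (hC : IsPerfectCode C)
    (hS : Function.Surjective S) (hSC : ∀ c ∈ C, S c = s₀) (s : Q) :
    Nat.card {e : {e : ι → K // hammingNorm e ≤ 1} // S e = s} * Nat.card Q =
      Fintype.card ι * (Nat.card K - 1) + 1 := by
  have : Finite Q := Finite.of_surjective S hS
  have : Nonempty C := hC.nonempty.to_subtype
  have hfiber (s' : Q) : Nat.card {e : {e : ι → K // hammingNorm e ≤ 1} // S e = s'} =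
      Nat.card {e : {e : ι → K // hammingNorm e ≤ 1} // S e = s} := by
    refine Nat.eq_of_mul_eq_mul_right (Nat.card_pos (α := C)) ?_
    rw [hC.card_error_fiber_mul_card hSC, hC.card_error_fiber_mul_card hSC]
    exact Nat.card_congr (AddMonoidHom.fiberEquivOfSurjective (f := S.toAddMonoidHom) hS _ _)
  have := Fintype.ofFinite Q
  rw [← card_hammingNorm_le_one, ← Nat.card_congr
    (Equiv.sigmaFiberEquiv fun e : {e : ι → K // hammingNorm e ≤ 1} => S e), Nat.card_sigma]
  simp only [hfiber, Finset.sum_const, Finset.card_univ, smul_eq_mul, Nat.card_eq_fintype_card,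
    mul_comm]

end Syndrome

section Linear

variable {K : Type*} [Ring K] [DecidableEq K] {H : Submodule K (ι → K)}

theorem injOn_mkQ (hH : IsPerfectCode (H : Set (ι → K))) :
    Set.InjOn H.mkQ {e | hammingNorm e ≤ 1} := by
  intro e he f hf hef
  have hmem : e - f ∈ H := (Submodule.Quotient.eq H).1 hef
  rw [← sub_eq_zero, sub_eq_add_neg]
  exact hH.add_eq_zero_of_add_add_mem H.zero_mem he ((hammingNorm_neg f).trans_le hf)
    (by rwa [zero_add, ← sub_eq_add_neg])

theorem card_quotient {K : Type*} [Field K] [Finite K] [DecidableEq K] {H : Submodule K (ι → K)}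
    (hH : IsPerfectCode (H : Set (ι → K))) :
    Nat.card ((ι → K) ⧸ H) = Fintype.card ι * (Nat.card K - 1) + 1 := by
  have hzero : Nat.card {e : {e : ι → K // hammingNorm e ≤ 1} // H.mkQ e = 0} = 1 := by
    refine Nat.card_eq_one_iff_unique.2 ⟨⟨fun e f => ?_⟩, ⟨⟨0, by simp⟩, by simp⟩⟩
    exact Subtype.ext (Subtype.ext (hH.injOn_mkQ e.1.2 f.1.2 (e.2.trans f.2.symm)))
  have := hH.card_error_fiber_mul_card_syndrome H.mkQ_surjective
    (fun c hc => (Submodule.Quotient.mk_eq_zero H).2 hc) 0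
  rwa [hzero, one_mul] at this

end Linear

end Basic

end IsPerfectCode

section Blocks

variable {τ β K : Type*} [Fintype β] [Semiring K]

/-- The sums of the symbols of a word over its blocks. The positions of the word are a last
position `none` and blocks `{(i, j) | j : β}` indexed by `i : τ`. -/
def blockSum : (Option (τ × β) → K) →ₗ[K] (τ → K) :=
  LinearMap.pi fun i => ∑ j, LinearMap.proj (some (i, j))

theorem blockSum_apply (x : Option (τ × β) → K) (i : τ) :
    blockSum x i = ∑ j, x (some (i, j)) := by
  simp [blockSum]

variable [DecidableEq τ] [DecidableEq β]

@[simp]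
theorem blockSum_single_none (a : K) :
    blockSum (Pi.single none a : Option (τ × β) → K) = 0 := by
  ext i
  simp [blockSum_apply]

@[simp]
theorem blockSum_single_some (i : τ) (j : β) (a : K) :
    blockSum (Pi.single (some (i, j)) a : Option (τ × β) → K) = Pi.single i a := by
  ext i'
  obtain rfl | hi := eq_or_ne i' i
  · simp [blockSum_apply, Pi.single_apply]
  · simp [blockSum_apply, hi]

end Blocks

theorem hammingNorm_blockSum_le_one {τ β K : Type*} [Fintype τ] [Fintype β] [Semiring K]
    [DecidableEq K] {e : Option (τ × β) → K} (he : hammingNorm e ≤ 1) :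
    hammingNorm (blockSum e) ≤ 1 := by
  classical
  obtain rfl | ⟨_ | ⟨i, j⟩, a, -, rfl⟩ := hammingNorm_le_one_iff.1 he
  · simp
  · simp
  · rw [blockSum_single_some]
    exact hammingNorm_single_le_one i a

section Columns

variable {ι τ β K Q : Type*} [DecidableEq ι] [Fintype τ] [DecidableEq τ] [Fintype β]
  [DecidableEq β] [Field K] [DecidableEq K] [AddCommGroup Q] [Module K Q]
  {S : (ι → K) →ₗ[K] Q} {T : (τ → K) →ₗ[K] Q}

theorem injective_fst_of_map_single_eq (hT : Set.InjOn T {e | hammingNorm e ≤ 1})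
    {q : Option (τ × β) → ι × Kˣ} (hq_inj : ∀ i, Function.Injective fun j => q (some (i, j)))
    (hq : ∀ o, S (Pi.single (q o).1 (q o).2) = T (blockSum (Pi.single o 1))) :
    Function.Injective fun o => (q o).1 := by
  intro o o' hoo'
  have hsmul (o : Option (τ × β)) (a : K) :
      T (blockSum (Pi.single o a)) = S (Pi.single (q o).1 (a * (q o).2)) := by
    rw [← smul_eq_mul, Pi.single_smul, map_smul, hq, ← map_smul, ← map_smul, ← Pi.single_smul,
      smul_eq_mul, mul_one]
  -- Columns of `S` in the same position are proportional, hence so are the two columns of `T`.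
  have hprop : blockSum (Pi.single o ((q o').2 : K)) = blockSum (Pi.single o' ((q o).2 : K)) := by
    refine hT (hammingNorm_blockSum_le_one (hammingNorm_single_le_one _ _))
      (hammingNorm_blockSum_le_one (hammingNorm_single_le_one _ _)) ?_
    rw [hsmul, hsmul, show (q o).1 = (q o').1 from hoo', mul_comm]
  rcases o with _ | ⟨i, j⟩ <;> rcases o' with _ | ⟨i', j'⟩ <;>
    simp only [blockSum_single_none, blockSum_single_some] at hprop
  · rfl
  · exact absurd (Pi.single_eq_zero_iff.1 hprop.symm) (Units.ne_zero _)
  · exact absurd (Pi.single_eq_zero_iff.1 hprop) (Units.ne_zero _)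
  · obtain ⟨rfl, hunit⟩ := eq_and_eq_of_single_eq_single (Units.ne_zero _) hprop
    obtain rfl : j = j' := hq_inj i (Prod.ext hoo' (Units.ext hunit.symm))
    rfl

variable [Fintype ι]

theorem exists_map_single_eq_zero [Finite K]
    (hS : 1 < Nat.card {e : {e : ι → K // hammingNorm e ≤ 1} // S e = 0}) :
    ∃ (i : ι) (a : Kˣ), S (Pi.single i a) = 0 := by
  have := Finite.one_lt_card_iff_nontrivial.1 hS
  obtain ⟨⟨⟨e, he⟩, hSe⟩, hne⟩ := exists_ne
    (⟨⟨0, by simp⟩, map_zero S⟩ : {e : {e : ι → K // hammingNorm e ≤ 1} // S e = 0})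
  obtain rfl | ⟨i, a, ha, rfl⟩ := hammingNorm_le_one_iff.1 he
  · exact absurd rfl hne
  · exact ⟨i, Units.mk0 a ha, hSe⟩

theorem exists_injective_map_single_eq {κ : Type*} [Finite K] [Finite κ] {s : Q} (hs : s ≠ 0)
    (hcard : Nat.card {e : {e : ι → K // hammingNorm e ≤ 1} // S e = s} = Nat.card κ) :
    ∃ p : κ → ι × Kˣ, Function.Injective p ∧ ∀ j, S (Pi.single (p j).1 (p j).2) = s := by
  obtain ⟨E⟩ := (Finite.card_eq).1 hcard.symm
  have hsingle (j : κ) : ∃ p : ι × Kˣ, ((E j).1 : ι → K) = Pi.single p.1 p.2 := by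
    obtain h | ⟨i, a, ha, h⟩ := hammingNorm_le_one_iff.1 (E j).1.2
    · exact absurd ((E j).2.symm.trans (by rw [h, map_zero])) hs
    · exact ⟨(i, Units.mk0 a ha), h⟩
  choose p hp using hsingle
  refine ⟨p, fun j j' h => E.injective (Subtype.ext (Subtype.ext ?_)), fun j => ?_⟩
  · rw [hp, hp, h]
  · rw [← hp, (E j).2]

theorem exists_embedding_map_single_eq [Finite K] (hβ : 1 < Nat.card β)
    (hS : ∀ s, Nat.card {e : {e : ι → K // hammingNorm e ≤ 1} // S e = s} = Nat.card β)
    (hT : Set.InjOn T {e | hammingNorm e ≤ 1}) :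
    ∃ (g : Option (τ × β) ↪ ι) (a : Option (τ × β) → Kˣ),
      ∀ o, S (Pi.single (g o) (a o)) = T (blockSum (Pi.single o 1)) := by
  have hT_ne (i : τ) : T (Pi.single i 1) ≠ 0 := fun h => by
    simpa using hT (hammingNorm_single_le_one i 1) (by simp) (h.trans (map_zero T).symm)
  obtain ⟨k, b, hk⟩ := exists_map_single_eq_zero ((hS 0).symm ▸ hβ)
  choose p hp_inj hp using fun i => exists_injective_map_single_eq (hT_ne i) (hS _)
  let q : Option (τ × β) → ι × Kˣ := fun o => o.elim (k, b) fun ij => p ij.1 ij.2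
  have hq (o : Option (τ × β)) :
      S (Pi.single (q o).1 (q o).2) = T (blockSum (Pi.single o 1)) := by
    rcases o with _ | ⟨i, j⟩ <;> simp [q, hk, hp]
  exact ⟨⟨fun o => (q o).1, injective_fst_of_map_single_eq hT hp_inj hq⟩, fun o => (q o).2, hq⟩

end Columns

section Monomial

variable {ι κ K : Type*} [CommSemiring K]

/-- The monomial transformation that scales the symbols of a word by `u` and moves the symbol in
position `k` to the position `σ k`. -/
def monomialEquiv (σ : κ ≃ ι) (u : κ → Kˣ) : (κ → K) ≃ₗ[K] (ι → K) :=
  (LinearEquiv.piCongrRight fun k => LinearEquiv.smulOfUnit (u k)).trans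
    (LinearEquiv.funCongrLeft K K σ.symm)

theorem monomialEquiv_apply (σ : κ ≃ ι) (u : κ → Kˣ) (x : κ → K) (i : ι) :
    monomialEquiv σ u x i = u (σ.symm i) * x (σ.symm i) :=
  rfl

theorem monomialEquiv_single_one [DecidableEq ι] [DecidableEq κ] (σ : κ ≃ ι) (u : κ → Kˣ) (k : κ) :
    monomialEquiv σ u (Pi.single k 1) = Pi.single (σ k) (u k : K) := by
  ext i
  obtain ⟨l, rfl⟩ := σ.surjective i
  obtain rfl | hl := eq_or_ne l k
  · simp [monomialEquiv_apply]
  · simp [monomialEquiv_apply, hl]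

theorem hammingDist_monomialEquiv [Fintype ι] [Fintype κ] [DecidableEq K] (σ : κ ≃ ι)
    (u : κ → Kˣ) (x y : κ → K) :
    hammingDist (monomialEquiv σ u x) (monomialEquiv σ u y) = hammingDist x y :=
  (hammingDist_comp_equiv σ.symm (fun k => (u k : K) * x k) fun k => (u k : K) * y k).trans
    (hammingDist_comp (fun k a => (u k : K) * a) fun k => (u k).isUnit.mul_right_injective)

end Monomial

theorem exists_surjective_le_ker {K V W : Type*} [Field K] [AddCommGroup V] [Module K V]
    [Module.Finite K V] [AddCommGroup W] [Module K W] [Module.Finite K W] (D : Submodule K V)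
    (h : Module.finrank K W + Module.finrank K D ≤ Module.finrank K V) :
    ∃ S : V →ₗ[K] W, Function.Surjective S ∧ D ≤ LinearMap.ker S := by
  have hle : Module.finrank K W ≤ Module.finrank K (V ⧸ D) := by
    have := D.finrank_quotient_add_finrank
    omega
  obtain ⟨g, hg⟩ := finrank_le_iff_exists_linearMap.1 hle
  obtain ⟨f, hf⟩ := g.exists_leftInverse_of_injective (LinearMap.ker_eq_bot.2 hg)
  have hf_surj : Function.Surjective f := fun w => ⟨g w, LinearMap.congr_fun hf w⟩
  exact ⟨f ∘ₗ D.mkQ, hf_surj.comp D.mkQ_surjective,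
    D.ker_mkQ.symm.trans_le (LinearMap.ker_le_ker_comp _ _)⟩

namespace IsPerfectCode

section BlockIsometry

variable {ι τ K : Type*} [Fintype ι] [Fintype τ] [Field K] [Finite K] [DecidableEq K]
  {C : Set (ι → K)} {H : Submodule K (τ → K)}

theorem card_error_fiber_eq (hC : IsPerfectCode C) (hH : IsPerfectCode (H : Set (τ → K)))
    (hι : Fintype.card ι = Fintype.card τ * Nat.card K + 1) {S : (ι → K) →ₗ[K] (τ → K) ⧸ H}
    (hS : Function.Surjective S) {s₀ : (τ → K) ⧸ H} (hSC : ∀ c ∈ C, S c = s₀) (s : (τ → K) ⧸ H) :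
    Nat.card {e : {e : ι → K // hammingNorm e ≤ 1} // S e = s} = Nat.card K := by
  have hcount := hC.card_error_fiber_mul_card_syndrome hS hSC s
  rw [hH.card_quotient, hι] at hcount
  refine Nat.eq_of_mul_eq_mul_right (Nat.succ_pos (Fintype.card τ * (Nat.card K - 1)))
    (hcount.trans ?_)
  obtain ⟨r, hr⟩ : ∃ r, Nat.card K = r + 1 := Nat.exists_eq_add_one.2 Nat.card_pos
  rw [hr, Nat.add_sub_cancel, Nat.succ_eq_add_one]
  ring

theorem exists_equiv_mapsTo_blockSum {β : Type*} [Fintype β] (hC : IsPerfectCode C)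
    (hH : IsPerfectCode (H : Set (τ → K))) (hβ : Nat.card β = Nat.card K)
    (hι : Fintype.card ι = Fintype.card τ * Nat.card K + 1)
    (hrank : Module.finrank K ((τ → K) ⧸ H) + Module.finrank K (affineSpan K C).direction ≤
      Fintype.card ι) :
    ∃ f : (Option (τ × β) → K) ≃ (ι → K),
      (∀ x y, hammingDist (f x) (f y) = hammingDist x y) ∧ Set.MapsTo blockSum (f ⁻¹' C) H := by
  classical
  obtain ⟨S, hS, hker⟩ := exists_surjective_le_ker (W := (τ → K) ⧸ H) (affineSpan K C).direction
    (by rwa [Module.finrank_fintype_fun_eq_card])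
  obtain ⟨c, hc⟩ := hC.nonempty
  have hSC (x : ι → K) (hx : x ∈ C) : S x = S c := by
    rw [← sub_eq_zero, ← map_sub]
    exact hker (AffineSubspace.vsub_mem_direction (mem_affineSpan K hx) (mem_affineSpan K hc))
  obtain ⟨g, a, hga⟩ := exists_embedding_map_single_eq (β := β)
    (hβ.symm ▸ Finite.one_lt_card) (hβ.symm ▸ hC.card_error_fiber_eq hH hι hS hSC) hH.injOn_mkQ
  have hg : Function.Bijective g := (Fintype.bijective_iff_injective_and_card g).2
    ⟨g.injective, by simp [hι, ← hβ]⟩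
  let M := monomialEquiv (Equiv.ofBijective g hg) a
  have hSM : S ∘ₗ M.toLinearMap = H.mkQ ∘ₗ blockSum :=
    LinearMap.pi_ext' fun o => LinearMap.ext_ring <| by
      simpa [M, monomialEquiv_single_one] using hga o
  refine ⟨M.toEquiv.trans (Equiv.addRight c), fun x y => ?_, fun x hx => ?_⟩
  · exact (hammingDist_comp (fun i a => a + c i) fun i => add_left_injective (c i)).trans
      (hammingDist_monomialEquiv _ _ x y)
  · have hSx : S (M x) = 0 := by simpa using hSC _ hx
    exact (Submodule.Quotient.mk_eq_zero H).1 ((LinearMap.congr_fun hSM x).symm.trans hSx)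

end BlockIsometry

section BlockErrors

variable {τ β K : Type*} [Fintype τ] [Fintype β] [Ring K] [DecidableEq K]
  {D : Set (Option (τ × β) → K)} {H : Set (τ → K)}

theorem exists_error_blockSum_eq (hD : IsPerfectCode D) (hH : IsPerfectCode H)
    (hDH : Set.MapsTo blockSum D H) {x : Option (τ × β) → K} {v : τ → K}
    (hv : hammingNorm v ≤ 1) (hx : blockSum x + v ∈ H) :
    ∃ e, hammingNorm e ≤ 1 ∧ x + e ∈ D ∧ blockSum e = v := by
  obtain ⟨e, he, hxe⟩ := hD.exists_add_mem x
  have hsum : blockSum x + blockSum e ∈ H := map_add blockSum x e ▸ hDH hxe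
  have hneg {w : τ → K} (hw : hammingNorm w ≤ 1) : hammingNorm (-w) ≤ 1 :=
    (hammingNorm_neg w).trans_le hw
  have heq := hH.eq_of_add_eq_add hsum hx (hneg (hammingNorm_blockSum_le_one he)) (hneg hv)
    (by rw [add_neg_cancel_right, add_neg_cancel_right])
  exact ⟨e, he, hxe, add_left_cancel heq⟩

variable [DecidableEq τ] [DecidableEq β]

theorem exists_add_single_none_mem (hD : IsPerfectCode D) (hH : IsPerfectCode H)
    (hDH : Set.MapsTo blockSum D H) {x : Option (τ × β) → K} (hx : blockSum x ∈ H) :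
    ∃ a, x + Pi.single none a ∈ D := by
  obtain ⟨e, he, hxe, hsum⟩ := hD.exists_error_blockSum_eq hH hDH (v := 0) (x := x)
    (by simp) (by rwa [add_zero])
  obtain rfl | ⟨_ | ⟨i, j⟩, a, ha, rfl⟩ := hammingNorm_le_one_iff.1 he
  · exact ⟨0, by rwa [Pi.single_zero]⟩
  · exact ⟨a, hxe⟩
  · exact absurd (by simpa using hsum) ha

theorem exists_add_single_some_mem (hD : IsPerfectCode D) (hH : IsPerfectCode H)
    (hDH : Set.MapsTo blockSum D H) {x : Option (τ × β) → K} {i : τ} {b : K} (hb : b ≠ 0)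
    (hx : blockSum x + Pi.single i b ∈ H) : ∃ j, x + Pi.single (some (i, j)) b ∈ D := by
  obtain ⟨e, he, hxe, hsum⟩ := hD.exists_error_blockSum_eq hH hDH
    (hammingNorm_single_le_one i b) hx
  obtain rfl | ⟨_ | ⟨i', j⟩, a, ha, rfl⟩ := hammingNorm_le_one_iff.1 he
  · exact absurd (by simpa [eq_comm] using hsum) hb
  · exact absurd (by simpa [eq_comm] using hsum) hb
  · rw [blockSum_single_some] at hsum
    obtain ⟨rfl, rfl⟩ := eq_and_eq_of_single_eq_single ha hsum
    exact ⟨j, hxe⟩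

end BlockErrors

end IsPerfectCode

/-- The word whose symbols in the block `i` are all equal to `w i` and whose last symbol is zero. -/
def blockConst {τ β K : Type*} [Semiring K] : (τ → K) →ₗ[K] (Option (τ × β) → K) :=
  LinearMap.pi fun o => o.elim 0 fun p => LinearMap.proj p.1

theorem blockConst_single {τ β K : Type*} [DecidableEq τ] [Fintype β] [DecidableEq β]
    [Semiring K] (i : τ) (a : K) :
    (blockConst (Pi.single i a) : Option (τ × β) → K) = ∑ j, Pi.single (some (i, j)) a := by
  ext o
  rcases o with _ | ⟨i', j'⟩
  · simp [blockConst]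
  · obtain rfl | hi := eq_or_ne i' i
    · simp [blockConst, Pi.single_apply]
    · simp [blockConst, hi]

section Ternary

variable {τ : Type*}

/-- The word with block sums `μ`, differences `d` of the first two symbols of the blocks, and last
symbol `y`, normalised so that the first symbol of each block is zero. -/
def baseWord (μ d : τ → ZMod 3) (y : ZMod 3) : Option (τ × Fin 3) → ZMod 3 :=
  fun o => o.elim y fun p => ![0, d p.1, μ p.1 - d p.1] p.2

theorem blockSum_baseWord (μ d : τ → ZMod 3) (y : ZMod 3) : blockSum (baseWord μ d y) = μ := by
  ext i
  simp [blockSum_apply, baseWord, Fin.sum_univ_three]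

theorem baseWord_add_single_none [DecidableEq τ] (μ d : τ → ZMod 3) (y a : ZMod 3) :
    baseWord μ d y + Pi.single none a = baseWord μ d (y + a) := by
  ext o
  rcases o with _ | p <;> simp [baseWord]

theorem baseWord_add_single [DecidableEq τ] (μ d : τ → ZMod 3) (i : τ) (a y : ZMod 3) :
    baseWord μ (d + Pi.single i a) y =
      baseWord μ d y + Pi.single (some (i, 1)) a + Pi.single (some (i, 2)) (-a) := by
  ext o
  rcases o with _ | ⟨i', j⟩
  · simp [baseWord]
  · obtain rfl | hi := eq_or_ne i' i
    · fin_cases j <;> simp [baseWord, Pi.single_apply]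
      ring
    · simp [baseWord, hi]

theorem baseWord_add_blockConst (z : Option (τ × Fin 3) → ZMod 3) :
    baseWord (blockSum z) (fun i => z (some (i, 1)) - z (some (i, 0))) (z none) +
      blockConst (fun i => z (some (i, 0))) = z := by
  have three_eq_zero : (3 : ZMod 3) = 0 := rfl
  ext o
  rcases o with _ | ⟨i, j⟩
  · simp [baseWord, blockConst]
  · fin_cases j <;> simp [baseWord, blockConst, blockSum_apply, Fin.sum_univ_three]
    linear_combination z (some (i, 0)) * three_eq_zero

namespace IsPerfectCode

variable [Fintype τ] {D : Set (Option (τ × Fin 3) → ZMod 3)} {H : Set (τ → ZMod 3)}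

theorem add_blockConst_single_mem [DecidableEq τ] (hD : IsPerfectCode D) (hH : IsPerfectCode H)
    (hDH : Set.MapsTo blockSum D H) {z : Option (τ × Fin 3) → ZMod 3} (hz : z ∈ D) (i : τ)
    (a : ZMod 3) : z + blockConst (Pi.single i a) ∈ D := by
  obtain rfl | ha := eq_or_ne a 0
  · simpa using hz
  have three_mul_eq_zero : a + a + a = 0 := by
    have three_eq_zero : (3 : ZMod 3) = 0 := rfl
    linear_combination a * three_eq_zero
  let E (j : Fin 3) : Option (τ × Fin 3) → ZMod 3 := Pi.single (some (i, j)) a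
  have hx : blockSum (z + E 0 + E 1) + Pi.single i a ∈ H := by
    simpa [E, add_assoc, ← Pi.single_add, ← add_assoc a, three_mul_eq_zero] using hDH hz
  have notMem_of_ne {k j : Fin 3} (hkj : k ≠ j) : z + E k + (E j + E j) ∉ D := by
    intro h
    rw [← Pi.single_add] at h
    have hzero := hD.add_eq_zero_of_add_add_mem hz
      (hammingNorm_single_le_one _ _)
      (hammingNorm_single_le_one _ _) h
    exact ha (by simpa [E, hkj] using congrFun hzero (some (i, k)))
  rw [blockConst_single, Fin.sum_univ_three, ← add_assoc, ← add_assoc]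
  obtain ⟨j, hj⟩ := hD.exists_add_single_some_mem hH hDH ha hx
  match j, hj with
  | 0, hj => exact absurd (by rwa [add_right_comm z, add_assoc] at hj) (notMem_of_ne one_ne_zero)
  | 1, hj => exact absurd (by rwa [add_assoc] at hj) (notMem_of_ne zero_ne_one)
  | 2, hj => exact hj

theorem add_blockConst_mem_iff (hD : IsPerfectCode D) (hH : IsPerfectCode H)
    (hDH : Set.MapsTo blockSum D H) {z : Option (τ × Fin 3) → ZMod 3} (w : τ → ZMod 3) :
    z + blockConst w ∈ D ↔ z ∈ D := by
  classical
  have add_mem (w : τ → ZMod 3) : ∀ z ∈ D, z + blockConst w ∈ D := by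
    induction w using Pi.single_induction with
    | zero => simp
    | add v w hv hw => exact fun z hz => by rw [map_add, ← add_assoc]; exact hw _ (hv z hz)
    | single i a => exact fun z hz => hD.add_blockConst_single_mem hH hDH hz i a
  exact ⟨fun hz => by simpa using add_mem (-w) _ hz, add_mem w z⟩

theorem mem_iff_baseWord_mem (hD : IsPerfectCode D) (hH : IsPerfectCode H)
    (hDH : Set.MapsTo blockSum D H) (z : Option (τ × Fin 3) → ZMod 3) :
    z ∈ D ↔
      baseWord (blockSum z) (fun i => z (some (i, 1)) - z (some (i, 0))) (z none) ∈ D := by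
  conv_lhs => rw [← baseWord_add_blockConst z]
  exact hD.add_blockConst_mem_iff hH hDH _

theorem existsUnique_baseWord_mem (hD : IsPerfectCode D) (hH : IsPerfectCode H)
    (hDH : Set.MapsTo blockSum D H) {μ : τ → ZMod 3} (hμ : μ ∈ H) (d : τ → ZMod 3) :
    ∃! y, baseWord μ d y ∈ D := by
  classical
  obtain ⟨y, hy⟩ := hD.exists_add_single_none_mem hH hDH
    (x := baseWord μ d 0) (by rwa [blockSum_baseWord])
  rw [baseWord_add_single_none, zero_add] at hy
  refine ⟨y, hy, fun y' hy' => ?_⟩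
  have heq := hD.eq_of_add_eq_add hy' hy (e := Pi.single none (-y')) (f := Pi.single none (-y))
    (hammingNorm_single_le_one _ _)
    (hammingNorm_single_le_one _ _)
    (by simp only [baseWord_add_single_none, add_neg_cancel])
  exact congrFun heq none

theorem eq_of_baseWord_mem (hD : IsPerfectCode D) {μ d d' : τ → ZMod 3} {y : ZMod 3}
    (hd : baseWord μ d y ∈ D) (hd' : baseWord μ d' y ∈ D) (hdd' : hammingDist d d' ≤ 1) :
    d = d' := by
  classical
  obtain ⟨v, rfl⟩ : ∃ v, d' = d + v := ⟨d' - d, (add_sub_cancel d d').symm⟩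
  rw [hammingDist_self_add] at hdd'
  obtain rfl | ⟨i, a, -, rfl⟩ := hammingNorm_le_one_iff.1 hdd'
  · rw [add_zero]
  rw [baseWord_add_single] at hd'
  have hzero := hD.add_eq_zero_of_add_add_mem hd
    (hammingNorm_single_le_one _ _)
    (hammingNorm_single_le_one _ _) hd'
  have ha : a = 0 := by simpa using congrFun hzero (some (i, 1))
  rw [ha, Pi.single_zero, add_zero]

theorem exists_last_symbol (hD : IsPerfectCode D) (hH : IsPerfectCode H)
    (hDH : Set.MapsTo blockSum D H) :
    ∃ lam : H → (τ → ZMod 3) → ZMod 3,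
      (∀ μ d d', hammingDist d d' = 1 → lam μ d ≠ lam μ d') ∧
      ∀ z, z ∈ D ↔ ∃ μ : H, blockSum z = μ ∧
        z none = lam μ fun i => z (some (i, 1)) - z (some (i, 0)) := by
  choose lam hlam huniq using fun μ : H => hD.existsUnique_baseWord_mem hH hDH μ.2
  refine ⟨lam, fun μ d d' hdd' heq => ?_, fun z => ⟨fun hz => ?_, ?_⟩⟩
  · have := hD.eq_of_baseWord_mem (hlam μ d) (heq ▸ hlam μ d') hdd'.le
    simp [this] at hdd'
  · exact ⟨⟨blockSum z, hDH hz⟩, rfl, huniq _ _ _ ((hD.mem_iff_baseWord_mem hH hDH z).1 hz)⟩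
  · rintro ⟨μ, hμ, hlast⟩
    rw [hD.mem_iff_baseWord_mem hH hDH, hμ, hlast]
    exact hlam μ _

end IsPerfectCode

end Ternary

theorem isQuasigroup3_of_ne {t : ℕ} {f : Word t → ZMod 3}
    (hf : ∀ x y, hammingDist x y = 1 → f x ≠ f y) : IsQuasigroup3 f := by
  constructor
  · have hinj : Function.Injective fun x : Word t => (Fin.snoc x (f x) : Word (t + 1)) :=
      fun x y h => (Fin.snoc_injective2 h).1
    rw [← Set.image_univ, Set.ncard_image_of_injective _ hinj, Set.ncard_univ,
      Nat.card_eq_fintype_card]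
    simp
  · rintro _ ⟨x, rfl⟩ _ ⟨y, rfl⟩ hne
    have hxy : x ≠ y := by
      rintro rfl
      exact hne rfl
    have hpos := hammingDist_pos.2 hxy
    rw [hammingDist_snoc]
    split_ifs with h
    · omega
    · have := mt (hf x y) h
      omega

section Triples

variable {n t : ℕ}

/-- The numbering `3 i + j` of the positions in the blocks of three, followed by the last position
`n - 1`. -/
def blockEquiv (h : n = 3 * t + 1) : Option (Fin t × Fin 3) ≃ Fin n :=
  (finProdFinEquiv.optionCongr.trans finSuccEquivLast.symm).trans
    (finCongr (h.trans (by rw [mul_comm])).symm)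

theorem blockEquiv_none (h : n = 3 * t + 1) : blockEquiv h none = lastCoord h :=
  Fin.ext (mul_comm t 3)

theorem blockEquiv_some (h : n = 3 * t + 1) (i : Fin t) (j : Fin 3) :
    blockEquiv h (some (i, j)) = tripleCoord h i j :=
  Fin.ext (by simp [blockEquiv, tripleCoord, add_comm])

theorem mem_muComponent_iff (h : n = 3 * t + 1) {μ : Word t} {f : Word t → ZMod 3} {x : Word n} :
    x ∈ muComponent h μ f ↔ blockSum (x ∘ blockEquiv h) = μ ∧
      (x ∘ blockEquiv h) none =
        f fun i => (x ∘ blockEquiv h) (some (i, 1)) - (x ∘ blockEquiv h) (some (i, 0)) := by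
  simp only [muComponent, Set.mem_ofPred_eq, funext_iff, blockSum_apply, Fin.sum_univ_three,
    Function.comp_apply, blockEquiv_none, blockEquiv_some]
  refine and_congr_left' (forall_congr' fun i => ?_)
  rw [sub_sub, eq_sub_iff_add_eq, add_comm]

end Triples

/-- The automorphism of the Hamming graph given by a bijection preserving the Hamming distance. -/
def hammingGraphAut {n : ℕ} (f : Word n ≃ Word n)
    (hf : ∀ x y, hammingDist (f x) (f y) = hammingDist x y) :
    hammingGraph3 n ≃g hammingGraph3 n :=
  ⟨f, (congrArg (· = 1) (hf _ _)).to_iff⟩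

theorem IsHammingCode.finrank_quotient {k : ℕ} {H : Submodule (ZMod 3) (Word ((3 ^ k - 1) / 2))}
    (hH : IsHammingCode H) : Module.finrank (ZMod 3) (Word ((3 ^ k - 1) / 2) ⧸ H) = k := by
  have hsphere : (3 ^ k - 1) / 2 * (3 - 1) + 1 = 3 ^ k := by
    obtain ⟨r, hr⟩ : Odd (3 ^ k) := Odd.pow (by decide)
    omega
  have hcard := hH.isPerfectCode.card_quotient
  rw [Module.natCard_eq_pow_finrank (K := ZMod 3), Nat.card_zmod, Fintype.card_fin,
    hsphere] at hcard
  exact Nat.pow_right_injective (by decide : 2 ≤ 3) hcard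

theorem le_half_three_pow_sub_one (m : ℕ) : m ≤ (3 ^ m - 1) / 2 := by
  have bernoulli : 1 + m * 2 ≤ 3 ^ m :=
    mod_cast one_add_mul_le_pow_of_sq_nonneg (R := ℕ) (a := 2) (by simp) (by simp) (by simp) m
  omega

theorem theorem3p1 (m : ℕ) (hm : 1 ≤ m)
    (C : Set (Word ((3 ^ m - 1) / 2)))
    (hC : IsOnePerfect (hammingGraph3 ((3 ^ m - 1) / 2)) C)
    (hrank : codeRank C ≤ ((3 ^ m - 1) / 2 - m) + 1)
    (Cstar : Submodule (ZMod 3) (Word ((3 ^ (m - 1) - 1) / 2)))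
    (hCstar : IsHammingCode Cstar) :
    ∃ (ψ : hammingGraph3 ((3 ^ m - 1) / 2) ≃g hammingGraph3 ((3 ^ m - 1) / 2))
      (lam : Cstar → Word ((3 ^ (m - 1) - 1) / 2) → ZMod 3),
      (∀ μ : Cstar, IsQuasigroup3 (lam μ)) ∧
      ψ '' C = ⋃ μ : Cstar, muComponent (length_eq_three_mul_add_one hm) μ.1 (lam μ) := by
  have hlen := length_eq_three_mul_add_one hm
  have hC' := hC.isPerfectCode
  have hH := hCstar.isPerfectCode
  obtain ⟨f, hf, hblock⟩ := hC'.exists_equiv_mapsTo_blockSum (β := Fin 3) hH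
    (by simp) (by simpa [mul_comm] using hlen) (by
      rw [hCstar.finrank_quotient, Fintype.card_fin]
      have := le_half_three_pow_sub_one m
      have : Module.finrank (ZMod 3) (affineSpan (ZMod 3) C).direction ≤ _ := hrank
      omega)
  obtain ⟨lam, hlam, hmem⟩ := (hC'.preimage f hf).exists_last_symbol hH hblock
  let e := (Equiv.arrowCongr (blockEquiv hlen) (Equiv.refl (ZMod 3))).symm.trans f
  refine ⟨(hammingGraphAut e fun x y => ?_).symm, lam, fun μ => isQuasigroup3_of_ne (hlam μ), ?_⟩
  · exact (hf _ _).trans (hammingDist_comp_equiv (blockEquiv hlen) x y)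
  · ext x
    simp only [Set.mem_iUnion, mem_muComponent_iff]
    exact (Set.ext_iff.1 (e.symm.image_eq_preimage_symm C) x).trans (hmem (x ∘ blockEquiv hlen))
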